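/- Let $(X,d)$ be a compact metric space and $m$ a Borel probability measure on $X$. Let $\mathcal P(X)$ be the set of Borel probability measures on $X$, with the quadratic Wasserstein distance $W_2(\mu,\nu)^2=\inf_\gamma\int d(x,y)^2\,\mathrm d\gamma(x,y)$, the infimum being over all Borel probability measures $\gamma$ on $X\times X$ with marginals $\mu$ and $\nu$. For $\mu\in\mathcal P(X)$ let $\mathrm{Ent}_m(\mu)=\int f\log f\,\mathrm dm\in[0,\infty]$ if $\mu=f\,m$, and $\mathrm{Ent}_m(\mu)=+\infty$ if $\mu$ is not absolutely continuous with respect to $m$; let $D(\mathrm{Ent}_m)=\{\mu:\mathrm{Ent}_m(\mu)<\infty\}$. For $\mu\in D(\mathrm{Ent}_m)$ let $$|D^-\mathrm{Ent}_m|(\mu)=\limsup_{\nu\to\mu,\ \nu\ne\mu}\frac{[\mathrm{Ent}_m(\nu)-\mathrm{Ent}_m(\mu)]^-}{W_2(\nu,\mu)}\in[0,\infty]$$ be the descending slope, where $\nu\to\mu$ is understood with respect to $W_2$ (the slope is $0$ if $\mu$ is isolated). Suppose that $(X,d,m)$ is a $CD(K,\infty)$ space for some $K\in\mathbb R$, i.e.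 for all $\mu_0,\mu_1\in D(\mathrm{Ent}_m)$ there is a curve $(\mu_t)_{t\in[0,1]}$ in $\mathcal P(X)$ from $\mu_0$ to $\mu_1$ with $W_2(\mu_s,\mu_t)=|s-t|\,W_2(\mu_0,\mu_1)$ for all $s,t\in[0,1]$ and $$\mathrm{Ent}_m(\mu_t)\le(1-t)\,\mathrm{Ent}_m(\mu_0)+t\,\mathrm{Ent}_m(\mu_1)-\tfrac K2\,t(1-t)\,W_2(\mu_0,\mu_1)^2\qquad\text{for all }t\in[0,1].$$ Then the map $D(\mathrm{Ent}_m)\ni\mu\mapsto|D^-\mathrm{Ent}_m|^2(\mu)\in[0,\infty]$ is convex with respect to linear interpolation of measures: for all $\mu_0,\mu_1\in D(\mathrm{Ent}_m)$ and $t\in[0,1]$, the measure $(1-t)\mu_0+t\mu_1$ belongs to $D(\mathrm{Ent}_m)$ and $$|D^-\mathrm{Ent}_m|^2\big((1-t)\mu_0+t\mu_1\big)\le(1-t)\,|D^-\mathrm{Ent}_m|^2(\mu_0)+t\,|D^-\mathrm{Ent}_m|^2(\mu_1),$$ with the convention $0\cdot\infty=0$. -/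

import Mathlib

open MeasureTheory Set
open scoped ENNReal

noncomputable section

/-- `γ` is a coupling (admissible plan) of `μ` and `ν`: a measure on `X × X` with first
marginal `μ` and second marginal `ν`. -/
def IsCoupling {X : Type*} [MeasurableSpace X] (γ : Measure (X × X))
    (μ ν : ProbabilityMeasure X) : Prop :=
  γ.map Prod.fst = (μ : Measure X) ∧ γ.map Prod.snd = (ν : Measure X)

/-- The quadratic Wasserstein distance: the square root of the infimum of
`∫ d(x,y)² dγ(x,y)` among all couplings `γ` of `μ` and `ν`. -/
def wassersteinTwo {X : Type*} [MetricSpace X] [MeasurableSpace X]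
    (μ ν : ProbabilityMeasure X) : ℝ≥0∞ :=
  (⨅ (γ : Measure (X × X)) (_ : IsCoupling γ μ ν), ∫⁻ p, edist p.1 p.2 ^ 2 ∂γ) ^ (1 / 2 : ℝ)

/-- The relative entropy of `μ` with respect to `m`, that is `∫ f log f dm` if `μ = f m`
and `+∞` otherwise (for probability measures this is the Kullback-Leibler divergence). -/
def relEntropy {X : Type*} [MeasurableSpace X] (m : Measure X)
    (μ : ProbabilityMeasure X) : ℝ≥0∞ :=
  InformationTheory.klDiv (μ : Measure X) m

/-- `c : [0,1] → Y` is a constant speed geodesic for the distance `dist`: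
`dist (c s) (c t) = |s - t| dist (c 0) (c 1)` for all `s, t ∈ [0,1]`. -/
def IsConstantSpeedGeodesic {Y : Type*} (dist : Y → Y → ℝ≥0∞) (c : unitInterval → Y) : Prop :=
  ∀ s t : unitInterval, dist (c s) (c t) = ENNReal.ofReal |(s : ℝ) - (t : ℝ)| * dist (c 0) (c 1)

/-- The descending slope of `f : Y → [0,∞]`, with respect to the distance `dist`, at a point
`x` where `f` is finite: the upper limit of `[f y - f x]⁻ / dist y x` as `y → x`, `y ≠ x`.
Subtraction in `[0,∞]` is truncated, so `f x - f y` is the negative part of `f y - f x`. If `x`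
is isolated, the value is `0`. -/
def descendingSlope {Y : Type*} (dist : Y → Y → ℝ≥0∞) (f : Y → ℝ≥0∞) (x : Y) : ℝ≥0∞ :=
  ⨅ (r : ℝ≥0∞) (_ : 0 < r), ⨆ (y : Y) (_ : y ≠ x ∧ dist y x < r), (f x - f y) / dist y x

/-- `(X, d, m)` is a `CD(K,∞)` space: any two probability measures of finite entropy are joined
by a constant speed geodesic of the Wasserstein space along which the relative entropy is
`K`-convex (with respect to the two end points). -/
def IsCDInfty {X : Type*} [MetricSpace X] [MeasurableSpace X] (m : Measure X) (K : ℝ) : Prop :=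
  ∀ μ₀ μ₁ : ProbabilityMeasure X, relEntropy m μ₀ < ∞ → relEntropy m μ₁ < ∞ →
    ∃ c : unitInterval → ProbabilityMeasure X,
      c 0 = μ₀ ∧ c 1 = μ₁ ∧ IsConstantSpeedGeodesic wassersteinTwo c ∧
      ∀ t : unitInterval, relEntropy m (c t) < ∞ ∧
        (relEntropy m (c t)).toReal ≤
          (1 - (t : ℝ)) * (relEntropy m μ₀).toReal + (t : ℝ) * (relEntropy m μ₁).toReal
            - K / 2 * (t : ℝ) * (1 - (t : ℝ)) * (wassersteinTwo μ₀ μ₁).toReal ^ 2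

/-- The linear interpolation `(1 - t) μ₀ + t μ₁` of two probability measures, `t ∈ [0,1]`. -/
def linearInterpolation {X : Type*} [MeasurableSpace X] (μ₀ μ₁ : ProbabilityMeasure X)
    (t : unitInterval) : ProbabilityMeasure X :=
  ⟨ENNReal.ofReal (1 - (t : ℝ)) • (μ₀ : Measure X) + ENNReal.ofReal (t : ℝ) • (μ₁ : Measure X),
    ⟨by
      have h : (1 - (t : ℝ)) + (t : ℝ) = 1 := by ring
      simp only [Measure.add_apply, Measure.smul_apply, measure_univ, smul_eq_mul, mul_one]
      rw [← ENNReal.ofReal_add (sub_nonneg.2 t.2.2) t.2.1, h, ENNReal.ofReal_one]⟩⟩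

end

/-!
The squared slope is convex because the entropy drop along a fixed transport plan is convex while
its cost is linear.

Let `μ = a μ₀ + b μ₁` with positive weights and let `γ` be any plan between a competitor `ν` and
`μ`. Reweighting `γ` by the bounded densities `dμᵢ/dμ` splits it as `γ = a γ₀ + b γ₁`, where `γᵢ` is
a plan between some `νᵢ` and `μᵢ` and `ν = a ν₀ + b ν₁`. The compensation identity
(`klDiv_convexCombination`)

  `a Ent(μ₀) + b Ent(μ₁) = Ent(μ) + a Ent(μ₀ | μ) + b Ent(μ₁ | μ)`,

its analogue for `ν`, and the data processing inequality `Ent(νᵢ | ν) ≤ Ent(μᵢ | μ)`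
(`klDiv_map_fst_reweightedPlan_le`) give

  `Ent(μ) - Ent(ν) ≤ a (Ent(μ₀) - Ent(ν₀)) + b (Ent(μ₁) - Ent(ν₁))`.

The condition `CD(K,∞)` turns the slope, a local quantity, into a global bound
(`toReal_relEntropy_sub_le`): `Ent(μᵢ) - Ent(νᵢ) ≤ sᵢ W₂(νᵢ,μᵢ) - K/2 W₂(νᵢ,μᵢ)²`, where `sᵢ` is the
slope at `μᵢ`. As `W₂(νᵢ,μᵢ)²` is at most the cost `Cᵢ` of `γᵢ` and `a C₀ + b C₁` is the cost `C` of
`γ`, the Cauchy-Schwarz inequality yields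

  `Ent(μ) - Ent(ν) ≤ √(a s₀² + b s₁²) √C + |K|/2 C`

(`relEntropy_sub_le_of_isCoupling`). Taking the infimum over `γ` replaces `C` by `W₂(ν,μ)²`; dividing
by `W₂(ν,μ)` and letting it tend to `0` bounds the slope at `μ` by `√(a s₀² + b s₁²)`.
-/

/-! ### Relative entropy of convex combinations -/

open InformationTheory in
/-- Pointwise form of `klDiv_convexCombination`: `f` plays the role of the density `dμ/dm` and `g₀`,
`g₁` those of `dμ₀/dμ`, `dμ₁/dμ`, so that `a g₀ + b g₁ = 1` where `f ≠ 0`. -/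
theorem weighted_klFun_mul {a b f g₀ g₁ : ℝ} (hab : a + b = 1) (hg : f * (a * g₀ + b * g₁) = f) :
    a * klFun (g₀ * f) + b * klFun (g₁ * f) =
      klFun f + (a * (f * klFun g₀) + b * (f * klFun g₁)) := by
  have key : ∀ g : ℝ, klFun (g * f) = f * klFun g + g * klFun f + (1 - f) * (1 - g) := by
    intro g
    rcases eq_or_ne f 0 with rfl | hf
    · simp [klFun_apply]
    rcases eq_or_ne g 0 with rfl | hg
    · simp [klFun_apply]
    simp only [klFun_apply, Real.log_mul hg hf]
    ring
  rw [key, key]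
  rcases eq_or_ne f 0 with rfl | hf
  · simp only [klFun_zero]
    linear_combination hab
  have hg' : a * g₀ + b * g₁ = 1 := by
    have : f * (a * g₀ + b * g₁) = f * 1 := by rw [hg, mul_one]
    exact mul_left_cancel₀ hf this
  linear_combination (klFun f - (1 - f)) * hg' + (1 - f) * hab

theorem ae_rnDeriv_convexCombination {α : Type*} [MeasurableSpace α] {μ₀ μ₁ μ : Measure α}
    [IsFiniteMeasure μ₀] [IsFiniteMeasure μ₁] [IsFiniteMeasure μ] {a b : ℝ≥0∞}
    (ha : a ≠ ∞) (hb : b ≠ ∞) (hμ : μ = a • μ₀ + b • μ₁) :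
    ∀ᵐ x ∂μ, a * μ₀.rnDeriv μ x + b * μ₁.rnDeriv μ x = 1 := by
  have : IsFiniteMeasure (a • μ₀) := Measure.smul_finite μ₀ ha
  have : IsFiniteMeasure (b • μ₁) := Measure.smul_finite μ₁ hb
  have h := Measure.rnDeriv_add (a • μ₀) (b • μ₁) μ
  rw [← hμ] at h
  filter_upwards [h, Measure.rnDeriv_self μ, Measure.rnDeriv_smul_left_of_ne_top μ₀ μ ha,
    Measure.rnDeriv_smul_left_of_ne_top μ₁ μ hb] with x h1 h2 h3 h4
  rw [h2] at h1
  simp only [Pi.add_apply, h3, h4, Pi.smul_apply, smul_eq_mul] at h1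
  exact h1.symm

open InformationTheory in
/-- Compensation identity: if `μ = a μ₀ + b μ₁` with `a + b = 1`, the defect of convexity of the
entropy at `μ` is `a Ent(μ₀ | μ) + b Ent(μ₁ | μ)`. It holds in `[0,∞]`, since every integrand
involved is nonnegative. -/
theorem klDiv_convexCombination {α : Type*} [MeasurableSpace α] {μ₀ μ₁ μ m : Measure α}
    [IsFiniteMeasure μ₀] [IsFiniteMeasure μ₁] [IsFiniteMeasure μ] [IsFiniteMeasure m] {a b : ℝ≥0∞}
    (ha : a ≠ 0) (hb : b ≠ 0) (hab : a + b = 1) (hμ : μ = a • μ₀ + b • μ₁) (hμm : μ ≪ m) :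
    a * klDiv μ₀ m + b * klDiv μ₁ m = klDiv μ m + (a * klDiv μ₀ μ + b * klDiv μ₁ μ) := by
  have ha' : a ≠ ∞ := by rintro rfl; simp at hab
  have hb' : b ≠ ∞ := by rintro rfl; simp at hab
  have h0 : μ₀ ≪ μ := by
    rw [hμ]
    exact (Measure.absolutelyContinuous_smul ha).trans (Measure.AbsolutelyContinuous.rfl.add_right _)
  have h1 : μ₁ ≪ μ := by
    rw [hμ, add_comm]
    exact (Measure.absolutelyContinuous_smul hb).trans (Measure.AbsolutelyContinuous.rfl.add_right _)
  have hsum : ∀ᵐ x ∂m, μ.rnDeriv m x ≠ 0 → a * μ₀.rnDeriv μ x + b * μ₁.rnDeriv μ x = 1 := by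
    have h := ae_rnDeriv_convexCombination ha' hb' hμ
    nth_rw 3 [← Measure.withDensity_rnDeriv_eq μ m hμm] at h
    exact (ae_withDensity_iff (Measure.measurable_rnDeriv μ m)).1 h
  have hm : ∀ ρ σ : Measure α,
      Measurable fun x => ENNReal.ofReal (klFun (ρ.rnDeriv σ x).toReal) := fun ρ σ =>
    (measurable_klFun.comp (Measure.measurable_rnDeriv ρ σ).ennreal_toReal).ennreal_ofReal
  have hd (ρ : Measure α) : Measurable fun x =>
      μ.rnDeriv m x * ENNReal.ofReal (klFun (ρ.rnDeriv μ x).toReal) :=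
    (Measure.measurable_rnDeriv μ m).mul (hm ρ μ)
  rw [klDiv_eq_lintegral_klFun_of_ac (h0.trans hμm), klDiv_eq_lintegral_klFun_of_ac (h1.trans hμm),
    klDiv_eq_lintegral_klFun_of_ac hμm, klDiv_eq_lintegral_klFun_of_ac h0,
    klDiv_eq_lintegral_klFun_of_ac h1,
    ← lintegral_rnDeriv_mul hμm (hm μ₀ μ).aemeasurable,
    ← lintegral_rnDeriv_mul hμm (hm μ₁ μ).aemeasurable,
    ← lintegral_const_mul a (hm μ₀ m), ← lintegral_const_mul b (hm μ₁ m),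
    ← lintegral_const_mul a (hd μ₀), ← lintegral_const_mul b (hd μ₁),
    ← lintegral_add_left ((hm μ₀ m).const_mul a),
    ← lintegral_add_left ((hd μ₀).const_mul a), ← lintegral_add_left (hm μ m)]
  refine lintegral_congr_ae ?_
  filter_upwards [hsum, Measure.rnDeriv_mul_rnDeriv (κ := m) h0,
    Measure.rnDeriv_mul_rnDeriv (κ := m) h1, μ.rnDeriv_ne_top m] with x hx e0 e1 hf
  rw [← e0, ← e1]
  simp only [Pi.mul_apply, ENNReal.toReal_mul]
  generalize μ.rnDeriv m x = f at *
  generalize μ₀.rnDeriv μ x = g₀ at *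
  generalize μ₁.rnDeriv μ x = g₁ at *
  have hreal : f.toReal * (a.toReal * g₀.toReal + b.toReal * g₁.toReal) = f.toReal := by
    rcases eq_or_ne f 0 with rfl | hf0
    · simp
    have h := hx hf0
    have hg₀ : a * g₀ ≠ ∞ := ne_top_of_le_ne_top ENNReal.one_ne_top (h ▸ le_self_add)
    have hg₁ : b * g₁ ≠ ∞ := ne_top_of_le_ne_top ENNReal.one_ne_top (h ▸ le_add_self)
    rw [← ENNReal.toReal_mul, ← ENNReal.toReal_mul, ← ENNReal.toReal_add hg₀ hg₁, h]
    simp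
  have habr : a.toReal + b.toReal = 1 := by rw [← ENNReal.toReal_add ha' hb', hab]; simp
  have key := weighted_klFun_mul habr hreal
  have hk : ∀ y : ℝ≥0∞, 0 ≤ klFun y.toReal := fun y => klFun_nonneg ENNReal.toReal_nonneg
  have hk' : ∀ y z : ℝ≥0∞, 0 ≤ klFun (y.toReal * z.toReal) := fun y z =>
    klFun_nonneg (by positivity)
  have := hk f
  have := hk g₀
  have := hk g₁
  have := hk' g₀ f
  have := hk' g₁ f
  rw [← ENNReal.ofReal_toReal ha', ← ENNReal.ofReal_toReal hb', ← ENNReal.ofReal_toReal hf]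
  simp only [ENNReal.toReal_ofReal ENNReal.toReal_nonneg]
  repeat rw [← ENNReal.ofReal_mul (by positivity)]
  repeat rw [← ENNReal.ofReal_add (by positivity) (by positivity)]
  rw [key]

/-! ### Reweighting a transport plan -/

/-- The plan `γ`, with second marginal `μ`, reweighted so that its second marginal becomes `μ'`: its
density with respect to `γ` is `(x, y) ↦ dμ'/dμ (y)`. It moves `μ'` along the conditional transports
given by `γ`. The second marginal is the reweighted one because the descending slope at `μ` is
written with `dist ν μ`, where `μ` comes second. -/
noncomputable def reweightedPlan {X : Type*} [MeasurableSpace X] (γ : Measure (X × X))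
    (μ' μ : Measure X) : Measure (X × X) :=
  γ.withDensity fun p => μ'.rnDeriv μ p.2

theorem map_snd_reweightedPlan {X : Type*} [MeasurableSpace X] {γ : Measure (X × X)}
    {μ' μ : Measure X} [IsFiniteMeasure μ'] [IsFiniteMeasure μ]
    (hγ : γ.map Prod.snd = μ) (h : μ' ≪ μ) : (reweightedPlan γ μ' μ).map Prod.snd = μ' := by
  ext s hs
  rw [Measure.map_apply measurable_snd hs, reweightedPlan,
    withDensity_apply _ (measurable_snd hs), ← setLIntegral_map hs
    (Measure.measurable_rnDeriv μ' μ) measurable_snd, hγ, ← withDensity_apply _ hs,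
    Measure.withDensity_rnDeriv_eq _ _ h]

theorem isProbabilityMeasure_reweightedPlan {X : Type*} [MeasurableSpace X] {γ : Measure (X × X)}
    {μ' μ : Measure X} [IsProbabilityMeasure μ'] [IsFiniteMeasure μ]
    (hγ : γ.map Prod.snd = μ) (h : μ' ≪ μ) : IsProbabilityMeasure (reweightedPlan γ μ' μ) := by
  have : IsProbabilityMeasure ((reweightedPlan γ μ' μ).map Prod.snd) := by
    rw [map_snd_reweightedPlan hγ h]; infer_instance
  exact Measure.isProbabilityMeasure_of_map Prod.snd

open InformationTheory in
/-- Transporting both `μ'` and `μ` along `γ` does not increase the entropy of `μ'` relative to `μ`: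
`Ent(γ' | γ) = Ent(μ' | μ)` for the reweighted plan `γ'`, and the data processing inequality applies
to the projection onto the other marginal. -/
theorem klDiv_map_fst_reweightedPlan_le {X : Type*} [MeasurableSpace X] {γ : Measure (X × X)}
    {μ' μ : Measure X} [IsProbabilityMeasure μ'] [IsFiniteMeasure μ] [IsFiniteMeasure γ]
    (hγ : γ.map Prod.snd = μ) (h : μ' ≪ μ) :
    klDiv ((reweightedPlan γ μ' μ).map Prod.fst) (γ.map Prod.fst) ≤ klDiv μ' μ := by
  have := isProbabilityMeasure_reweightedPlan hγ h
  refine (klDiv_map_le _ _ measurable_fst).trans (le_of_eq ?_)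
  have hg : Measurable fun p : X × X => μ'.rnDeriv μ p.2 :=
    (Measure.measurable_rnDeriv μ' μ).comp measurable_snd
  have hac : reweightedPlan γ μ' μ ≪ γ := withDensity_absolutelyContinuous _ _
  have hd : (reweightedPlan γ μ' μ).rnDeriv γ =ᵐ[γ] fun p => μ'.rnDeriv μ p.2 :=
    Measure.rnDeriv_withDensity γ hg
  rw [klDiv_eq_lintegral_klFun_of_ac hac, klDiv_eq_lintegral_klFun_of_ac h]
  have hmap := lintegral_map (μ := γ) (measurable_klFun.comp
    (Measure.measurable_rnDeriv μ' μ).ennreal_toReal).ennreal_ofReal measurable_snd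
  rw [hγ] at hmap
  refine Eq.trans ?_ hmap.symm
  refine lintegral_congr_ae ?_
  filter_upwards [hd] with p hp
  rw [hp, Function.comp_apply]

theorem convexCombination_reweightedPlan {X : Type*} [MeasurableSpace X] {γ : Measure (X × X)}
    {μ₀ μ₁ μ : Measure X} [IsFiniteMeasure μ₀] [IsFiniteMeasure μ₁] [IsFiniteMeasure μ]
    {a b : ℝ≥0∞} (ha : a ≠ ∞) (hb : b ≠ ∞) (hμ : μ = a • μ₀ + b • μ₁)
    (hγ : γ.map Prod.snd = μ) :
    γ = a • reweightedPlan γ μ₀ μ + b • reweightedPlan γ μ₁ μ := by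
  have hm (ρ : Measure X) : Measurable fun p : X × X => ρ.rnDeriv μ p.2 :=
    (Measure.measurable_rnDeriv ρ μ).comp measurable_snd
  have h := ae_rnDeriv_convexCombination ha hb hμ
  rw [← hγ] at h
  have h' := ae_of_ae_map measurable_snd.aemeasurable h
  rw [hγ] at h'
  rw [reweightedPlan, reweightedPlan, ← withDensity_smul _ (hm μ₀), ← withDensity_smul _ (hm μ₁),
    ← withDensity_add_left ((hm μ₀).const_smul a)]
  conv_lhs => rw [← withDensity_one (μ := γ)]
  refine withDensity_congr_ae ?_
  filter_upwards [h'] with p hp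
  simpa using hp.symm

/-! ### The Wasserstein distance and the slope in `CD(K,∞)` spaces -/

theorem wassersteinTwo_sq {X : Type*} [MetricSpace X] [MeasurableSpace X]
    (μ ν : ProbabilityMeasure X) : wassersteinTwo μ ν ^ 2 =
      ⨅ (γ : Measure (X × X)) (_ : IsCoupling γ μ ν), ∫⁻ p, edist p.1 p.2 ^ 2 ∂γ := by
  rw [wassersteinTwo, ← ENNReal.rpow_natCast, ← ENNReal.rpow_mul]
  norm_num

theorem wassersteinTwo_sq_le {X : Type*} [MetricSpace X] [MeasurableSpace X]
    {μ ν : ProbabilityMeasure X} {γ : Measure (X × X)} (hγ : IsCoupling γ μ ν) :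
    wassersteinTwo μ ν ^ 2 ≤ ∫⁻ p, edist p.1 p.2 ^ 2 ∂γ := by
  rw [wassersteinTwo_sq]
  exact iInf₂_le γ hγ

/-- The product coupling has cost at most the squared diameter, which is finite by compactness. -/
theorem wassersteinTwo_ne_top {X : Type*} [MetricSpace X] [CompactSpace X] [MeasurableSpace X]
    (μ ν : ProbabilityMeasure X) : wassersteinTwo μ ν ≠ ∞ := by
  have hγ : IsCoupling ((μ : Measure X).prod (ν : Measure X)) μ ν := by
    constructor <;> simp
  have hdiam : Metric.ediam (univ : Set X) ≠ ∞ := isCompact_univ.isBounded.ediam_ne_top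
  have h : ∫⁻ p : X × X, edist p.1 p.2 ^ 2 ∂((μ : Measure X).prod (ν : Measure X)) ≤
      Metric.ediam (univ : Set X) ^ 2 := by
    refine (lintegral_mono (g := fun _ => Metric.ediam (univ : Set X) ^ 2) fun p => ?_).trans
      (by simp)
    exact pow_le_pow_left' (Metric.edist_le_ediam_of_mem (mem_univ _) (mem_univ _)) 2
  intro htop
  have := (wassersteinTwo_sq_le hγ).trans h
  rw [htop] at this
  simp [hdiam] at this

/-- In a `CD(K,∞)` space a finite descending slope, which is a local quantity, controls the entropy
drop `Ent μ - Ent ν` globally: it is at most `|D⁻Ent|(μ) W₂(ν,μ) - K/2 W₂(ν,μ)²`. The slope is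
tested along a geodesic from `ν` to `μ` on which the entropy is `K`-convex. -/
theorem toReal_relEntropy_sub_le {X : Type*} [MetricSpace X] [CompactSpace X] [MeasurableSpace X]
    {m : Measure X} {K : ℝ} (hCD : IsCDInfty m K) {μ ν : ProbabilityMeasure X}
    (hμ : relEntropy m μ < ∞) (hν : relEntropy m ν < ∞)
    (hs : descendingSlope wassersteinTwo (relEntropy m) μ ≠ ∞) :
    (relEntropy m μ).toReal - (relEntropy m ν).toReal ≤
      (descendingSlope wassersteinTwo (relEntropy m) μ).toReal * (wassersteinTwo ν μ).toReal -
        K / 2 * (wassersteinTwo ν μ).toReal ^ 2 := by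
  set e := wassersteinTwo ν μ with he
  have hetop : e ≠ ∞ := wassersteinTwo_ne_top ν μ
  set s := descendingSlope wassersteinTwo (relEntropy m) μ with hs_def
  -- The slope is an upper limit, so it bounds difference quotients near `μ` only up to an error `ε'`.
  refine le_of_forall_pos_le_add fun ε hε => ?_
  obtain ⟨ε', hε', hεe⟩ : ∃ ε' : ℝ, 0 < ε' ∧ ε' * e.toReal ≤ ε :=
    ⟨ε / (e.toReal + 1), by positivity, by
      rw [div_mul_eq_mul_div, div_le_iff₀ (by positivity)]
      nlinarith [ENNReal.toReal_nonneg (a := e)]⟩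
  have hlt : s < ENNReal.ofReal (s.toReal + ε') := by
    conv_lhs => rw [← ENNReal.ofReal_toReal hs]
    exact (ENNReal.ofReal_lt_ofReal_iff (by positivity)).2 (by linarith)
  conv_lhs at hlt => rw [hs_def, descendingSlope]
  simp only [iInf_lt_iff, exists_prop] at hlt
  obtain ⟨r, hr, hlt⟩ := hlt
  have hbound : ∀ y, y ≠ μ → wassersteinTwo y μ < r → relEntropy m y < ∞ →
      (relEntropy m μ).toReal - (relEntropy m y).toReal ≤
        (s.toReal + ε') * (wassersteinTwo y μ).toReal := by
    intro y hy hyr hytop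
    have h1 : (relEntropy m μ - relEntropy m y) / wassersteinTwo y μ ≤
        ENNReal.ofReal (s.toReal + ε') := (le_iSup₂_of_le y ⟨hy, hyr⟩ le_rfl).trans hlt.le
    have h2 : relEntropy m μ - relEntropy m y ≤
        ENNReal.ofReal (s.toReal + ε') * wassersteinTwo y μ :=
      (ENNReal.div_le_iff_le_mul (Or.inr ENNReal.ofReal_ne_top)
        (Or.inl (wassersteinTwo_ne_top y μ))).1 h1
    have h3 := ENNReal.toReal_mono
      (ENNReal.mul_ne_top ENNReal.ofReal_ne_top (wassersteinTwo_ne_top y μ)) h2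
    rw [ENNReal.toReal_mul, ENNReal.toReal_ofReal (by positivity)] at h3
    exact (ENNReal.le_toReal_sub hytop.ne).trans h3
  -- If `W₂(ν,μ) = 0`, then `ν` itself is a competitor in the definition of the slope; that `W₂`
  -- separates points is not needed.
  rcases eq_or_ne e 0 with he0 | he0
  · rcases eq_or_ne ν μ with rfl | hne
    · simp [he0, hε.le]
    have := hbound ν hne (by rwa [← he, he0]) hν
    rw [← he, he0] at this
    simp only [he0, ENNReal.toReal_zero] at this ⊢
    linarith
  have hepos : 0 < e.toReal := ENNReal.toReal_pos he0 hetop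
  obtain ⟨c, hc0, hc1, hgeo, hconv⟩ := hCD ν μ hν hμ
  have hdist : ∀ t : unitInterval,
      wassersteinTwo (c t) μ = ENNReal.ofReal (1 - (t : ℝ)) * e := by
    intro t
    have h := hgeo t 1
    rw [hc1, hc0, ← he, abs_sub_comm] at h
    simpa [abs_of_nonneg (sub_nonneg.2 t.2.2)] using h
  -- This makes `c t ≠ μ` for `t < 1`, as `c t` is at positive distance from `μ`.
  have hself : wassersteinTwo μ μ = 0 := by simpa [hc1] using hdist 1
  -- The `K`-convexity at time `1 - h`, divided by `h`.
  have hkey : ∀ᶠ h : ℝ in nhdsWithin 0 (Ioi 0),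
      (relEntropy m μ).toReal - (relEntropy m ν).toReal ≤
        (s.toReal + ε') * e.toReal - K / 2 * (1 - h) * e.toReal ^ 2 := by
    have hsmall : ∀ᶠ h : ℝ in nhdsWithin 0 (Ioi 0), ENNReal.ofReal h * e < r := by
      have : Filter.Tendsto (fun h : ℝ => ENNReal.ofReal h * e) (nhds 0) (nhds 0) := by
        have := ENNReal.Tendsto.mul_const (b := e)
          (ENNReal.continuous_ofReal.tendsto 0) (Or.inr hetop)
        simpa using this
      exact (this.eventually_lt_const hr).filter_mono nhdsWithin_le_nhds
    filter_upwards [hsmall, Ioo_mem_nhdsGT (zero_lt_one' ℝ)] with h hhr hh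
    let t : unitInterval := ⟨1 - h, by linarith [hh.2], by linarith [hh.1]⟩
    have ht : (t : ℝ) = 1 - h := rfl
    have hd := hdist t
    rw [ht, sub_sub_cancel] at hd
    have hne : c t ≠ μ := by
      intro heq
      rw [heq, hself, eq_comm, mul_eq_zero] at hd
      simp [he0, hh.1.not_ge] at hd
    obtain ⟨hfin, hle⟩ := hconv t
    have hb := hbound (c t) hne (hd ▸ hhr) hfin
    rw [hd, ENNReal.toReal_mul, ENNReal.toReal_ofReal hh.1.le] at hb
    rw [ht, ← he] at hle
    refine le_of_mul_le_mul_left ?_ hh.1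
    nlinarith
  have hlim : Filter.Tendsto
      (fun h : ℝ => (s.toReal + ε') * e.toReal - K / 2 * (1 - h) * e.toReal ^ 2)
      (nhdsWithin 0 (Ioi 0))
      (nhds ((s.toReal + ε') * e.toReal - K / 2 * (1 - 0) * e.toReal ^ 2)) :=
    (Continuous.tendsto (by fun_prop) 0).mono_left nhdsWithin_le_nhds
  have := ge_of_tendsto hlim hkey
  linarith

/-! ### Convexity of the squared slope -/

/-- Cauchy-Schwarz inequality in `ℝ²` with weights `a`, `b`. -/
theorem weighted_add_le_sqrt {a b c₀ c₁ s₀ s₁ : ℝ} (ha : 0 ≤ a) (hb : 0 ≤ b)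
    (hc₀ : 0 ≤ c₀) (hc₁ : 0 ≤ c₁) :
    a * (s₀ * √c₀) + b * (s₁ * √c₁) ≤ √(a * s₀ ^ 2 + b * s₁ ^ 2) * √(a * c₀ + b * c₁) := by
  rw [← Real.sqrt_mul (by positivity)]
  apply Real.le_sqrt_of_sq_le
  have h₀ := Real.sq_sqrt hc₀
  have h₁ := Real.sq_sqrt hc₁
  set x := √c₀
  set y := √c₁
  rw [← h₀, ← h₁]
  nlinarith [mul_nonneg (mul_nonneg ha hb) (sq_nonneg (s₀ * y - s₁ * x))]

theorem relEntropy_convexCombination_lt_top {X : Type*} [MeasurableSpace X] {m : Measure X}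
    [IsFiniteMeasure m] {μ₀ μ₁ μ : ProbabilityMeasure X} {a b : ℝ≥0∞} (ha : a ≠ 0) (hb : b ≠ 0)
    (hab : a + b = 1) (hμ : (μ : Measure X) = a • (μ₀ : Measure X) + b • (μ₁ : Measure X))
    (h₀ : relEntropy m μ₀ < ∞) (h₁ : relEntropy m μ₁ < ∞) : relEntropy m μ < ∞ := by
  have ha' : a ≠ ∞ := by rintro rfl; simp at hab
  have hb' : b ≠ ∞ := by rintro rfl; simp at hab
  have hμm : (μ : Measure X) ≪ m := by
    rw [hμ]
    exact ((InformationTheory.klDiv_ne_top_iff.1 h₀.ne).1.smul_left a).add_left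
      ((InformationTheory.klDiv_ne_top_iff.1 h₁.ne).1.smul_left b)
  refine lt_of_le_of_lt ?_ (ENNReal.add_lt_top.2
    ⟨ENNReal.mul_lt_top ha'.lt_top h₀, ENNReal.mul_lt_top hb'.lt_top h₁⟩)
  rw [relEntropy, relEntropy, relEntropy, klDiv_convexCombination ha hb hab hμ hμm]
  exact le_self_add

/-- The heart of the argument. A plan `γ` from `ν` to `μ = a μ₀ + b μ₁` splits as `a γ₀ + b γ₁` with
`γᵢ` a plan from some `νᵢ` to `μᵢ`. The entropy drop from `μ` to `ν` is at most the corresponding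
combination of the drops from `μᵢ` to `νᵢ`, whereas the cost of `γ` is equal to the combination of
the costs of the `γᵢ`. -/
theorem relEntropy_sub_le_of_isCoupling {X : Type*} [MetricSpace X] [CompactSpace X]
    [MeasurableSpace X] {m : Measure X} [IsProbabilityMeasure m] {K : ℝ} (hCD : IsCDInfty m K)
    {μ₀ μ₁ μ ν : ProbabilityMeasure X} {a b : ℝ≥0∞} (ha : a ≠ 0) (hb : b ≠ 0)
    (hab : a + b = 1) (hμ : (μ : Measure X) = a • (μ₀ : Measure X) + b • (μ₁ : Measure X))
    (h₀ : relEntropy m μ₀ < ∞) (h₁ : relEntropy m μ₁ < ∞) (hν : relEntropy m ν < ∞)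
    (hs₀ : descendingSlope wassersteinTwo (relEntropy m) μ₀ ≠ ∞)
    (hs₁ : descendingSlope wassersteinTwo (relEntropy m) μ₁ ≠ ∞)
    {γ : Measure (X × X)} (hγ : IsCoupling γ ν μ) (hC : ∫⁻ p, edist p.1 p.2 ^ 2 ∂γ ≠ ∞) :
    (relEntropy m μ).toReal - (relEntropy m ν).toReal ≤
      √(a.toReal * (descendingSlope wassersteinTwo (relEntropy m) μ₀).toReal ^ 2 +
        b.toReal * (descendingSlope wassersteinTwo (relEntropy m) μ₁).toReal ^ 2) *
        √(∫⁻ p, edist p.1 p.2 ^ 2 ∂γ).toReal +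
      |K| / 2 * (∫⁻ p, edist p.1 p.2 ^ 2 ∂γ).toReal := by
  have ha' : a ≠ ∞ := by rintro rfl; simp at hab
  have hb' : b ≠ ∞ := by rintro rfl; simp at hab
  have hμfin := relEntropy_convexCombination_lt_top ha hb hab hμ h₀ h₁
  have hμm : (μ : Measure X) ≪ m := (InformationTheory.klDiv_ne_top_iff.1 hμfin.ne).1
  have hνm : (ν : Measure X) ≪ m := (InformationTheory.klDiv_ne_top_iff.1 hν.ne).1
  have hγprob : IsProbabilityMeasure γ := by
    have : IsProbabilityMeasure (γ.map Prod.snd) := by rw [hγ.2]; infer_instance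
    exact Measure.isProbabilityMeasure_of_map Prod.snd
  have hidμ := klDiv_convexCombination ha hb hab hμ hμm
  have hfin : a * InformationTheory.klDiv (μ₀ : Measure X) μ +
      b * InformationTheory.klDiv (μ₁ : Measure X) μ ≠ ∞ := by
    refine ne_top_of_le_ne_top (ENNReal.add_lt_top.2
      ⟨ENNReal.mul_lt_top ha'.lt_top h₀, ENNReal.mul_lt_top hb'.lt_top h₁⟩).ne ?_
    rw [relEntropy, relEntropy, hidμ]
    exact le_add_self
  have hk₀ : InformationTheory.klDiv (μ₀ : Measure X) μ ≠ ∞ := fun h => by simp [h, ha] at hfin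
  have hk₁ : InformationTheory.klDiv (μ₁ : Measure X) μ ≠ ∞ := fun h => by simp [h, hb] at hfin
  have hac₀ := (InformationTheory.klDiv_ne_top_iff.1 hk₀).1
  have hac₁ := (InformationTheory.klDiv_ne_top_iff.1 hk₁).1
  have hp₀ := isProbabilityMeasure_reweightedPlan hγ.2 hac₀
  have hp₁ := isProbabilityMeasure_reweightedPlan hγ.2 hac₁
  have hsplit := convexCombination_reweightedPlan ha' hb' hμ hγ.2
  have hle₀ := klDiv_map_fst_reweightedPlan_le hγ.2 hac₀
  have hle₁ := klDiv_map_fst_reweightedPlan_le hγ.2 hac₁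
  rw [hγ.1] at hle₀ hle₁
  have hcpl₀ := map_snd_reweightedPlan hγ.2 hac₀
  have hcpl₁ := map_snd_reweightedPlan hγ.2 hac₁
  generalize reweightedPlan γ μ₀ μ = γ₀ at *
  generalize reweightedPlan γ μ₁ μ = γ₁ at *
  let ν₀ : ProbabilityMeasure X :=
    ⟨γ₀.map Prod.fst, Measure.isProbabilityMeasure_map measurable_fst.aemeasurable⟩
  let ν₁ : ProbabilityMeasure X :=
    ⟨γ₁.map Prod.fst, Measure.isProbabilityMeasure_map measurable_fst.aemeasurable⟩
  have hνsplit : (ν : Measure X) = a • (ν₀ : Measure X) + b • (ν₁ : Measure X) := by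
    rw [← hγ.1]
    conv_lhs => rw [hsplit]
    rw [Measure.map_add _ _ measurable_fst, Measure.map_smul, Measure.map_smul]
    rfl
  have hidν := klDiv_convexCombination ha hb hab hνsplit hνm
  -- The drop is convex under linear interpolation: by the compensation identity, this says that the
  -- relative entropies of the `νᵢ` with respect to `ν` do not exceed those of the `μᵢ` with respect
  -- to `μ`. Subtracted terms are moved across to avoid truncated subtraction.
  have hdrop : a * relEntropy m ν₀ + b * relEntropy m ν₁ + relEntropy m μ ≤
      a * relEntropy m μ₀ + b * relEntropy m μ₁ + relEntropy m ν := by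
    simp only [relEntropy]
    rw [hidμ, hidν, add_right_comm, add_comm (InformationTheory.klDiv (ν : Measure X) m),
      add_right_comm]
    gcongr
    · exact hle₀
    · exact hle₁
  have hRfin : a * relEntropy m μ₀ + b * relEntropy m μ₁ + relEntropy m ν ≠ ∞ :=
    (ENNReal.add_lt_top.2 ⟨ENNReal.add_lt_top.2
      ⟨ENNReal.mul_lt_top ha'.lt_top h₀, ENNReal.mul_lt_top hb'.lt_top h₁⟩, hν⟩).ne
  have hLfin := ne_top_of_le_ne_top hRfin hdrop
  have hν₀ : relEntropy m ν₀ < ∞ := lt_top_iff_ne_top.2 fun h => by simp [h, ha] at hLfin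
  have hν₁ : relEntropy m ν₁ < ∞ := lt_top_iff_ne_top.2 fun h => by simp [h, hb] at hLfin
  have hdropr := ENNReal.toReal_mono hRfin hdrop
  rw [ENNReal.toReal_add (by finiteness) hμfin.ne, ENNReal.toReal_add (by finiteness)
    (by finiteness), ENNReal.toReal_add (by finiteness) hν.ne, ENNReal.toReal_add (by finiteness)
    (by finiteness)] at hdropr
  simp only [ENNReal.toReal_mul] at hdropr
  have hcost : ∫⁻ p, edist p.1 p.2 ^ 2 ∂γ =
      a * ∫⁻ p, edist p.1 p.2 ^ 2 ∂γ₀ + b * ∫⁻ p, edist p.1 p.2 ^ 2 ∂γ₁ := by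
    conv_lhs => rw [hsplit]
    rw [lintegral_add_measure, lintegral_smul_measure, lintegral_smul_measure]
    rfl
  have hw₀ := wassersteinTwo_sq_le (μ := ν₀) (ν := μ₀) (γ := γ₀) ⟨rfl, hcpl₀⟩
  have hw₁ := wassersteinTwo_sq_le (μ := ν₁) (ν := μ₁) (γ := γ₁) ⟨rfl, hcpl₁⟩
  rw [hcost] at hC ⊢
  have hC₀ : ∫⁻ p, edist p.1 p.2 ^ 2 ∂γ₀ ≠ ∞ := fun h => by simp [h, ha] at hC
  have hC₁ : ∫⁻ p, edist p.1 p.2 ^ 2 ∂γ₁ ≠ ∞ := fun h => by simp [h, hb] at hC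
  have hw₀' := ENNReal.toReal_mono hC₀ hw₀
  have hw₁' := ENNReal.toReal_mono hC₁ hw₁
  have hslope₀ := toReal_relEntropy_sub_le hCD h₀ hν₀ hs₀
  have hslope₁ := toReal_relEntropy_sub_le hCD h₁ hν₁ hs₁
  rw [ENNReal.toReal_add (by finiteness) (by finiteness), ENNReal.toReal_mul, ENNReal.toReal_mul]
  rw [ENNReal.toReal_pow] at hw₀' hw₁'
  have hbound : ∀ {E s w c : ℝ}, 0 ≤ s → w ^ 2 ≤ c → E ≤ s * w - K / 2 * w ^ 2 →
      E ≤ s * √c + |K| / 2 * c := by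
    intro E s w c hs hw hE
    have h1 : s * w ≤ s * √c := mul_le_mul_of_nonneg_left (Real.le_sqrt_of_sq_le hw) hs
    have h2 : -K * w ^ 2 ≤ |K| * c :=
      mul_le_mul (neg_le_abs K) hw (sq_nonneg w) (abs_nonneg K)
    linarith
  have hE₀ := hbound ENNReal.toReal_nonneg hw₀' hslope₀
  have hE₁ := hbound ENNReal.toReal_nonneg hw₁' hslope₁
  have hCS := weighted_add_le_sqrt (a := a.toReal) (b := b.toReal)
    (s₀ := (descendingSlope wassersteinTwo (relEntropy m) μ₀).toReal)
    (s₁ := (descendingSlope wassersteinTwo (relEntropy m) μ₁).toReal)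
    ENNReal.toReal_nonneg ENNReal.toReal_nonneg
    (ENNReal.toReal_nonneg (a := ∫⁻ p, edist p.1 p.2 ^ 2 ∂γ₀))
    (ENNReal.toReal_nonneg (a := ∫⁻ p, edist p.1 p.2 ^ 2 ∂γ₁))
  have hE₀' := mul_le_mul_of_nonneg_left hE₀ (ENNReal.toReal_nonneg (a := a))
  have hE₁' := mul_le_mul_of_nonneg_left hE₁ (ENNReal.toReal_nonneg (a := b))
  linarith

theorem descendingSlope_sq_convexCombination_le {X : Type*} [MetricSpace X] [CompactSpace X]
    [MeasurableSpace X] {m : Measure X} [IsProbabilityMeasure m] {K : ℝ} (hCD : IsCDInfty m K)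
    {μ₀ μ₁ μ : ProbabilityMeasure X} {a b : ℝ≥0∞} (ha : a ≠ 0) (hb : b ≠ 0)
    (hab : a + b = 1) (hμ : (μ : Measure X) = a • (μ₀ : Measure X) + b • (μ₁ : Measure X))
    (h₀ : relEntropy m μ₀ < ∞) (h₁ : relEntropy m μ₁ < ∞) :
    descendingSlope wassersteinTwo (relEntropy m) μ ^ 2 ≤
      a * descendingSlope wassersteinTwo (relEntropy m) μ₀ ^ 2 +
        b * descendingSlope wassersteinTwo (relEntropy m) μ₁ ^ 2 := by
  have ha' : a ≠ ∞ := by rintro rfl; simp at hab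
  have hb' : b ≠ ∞ := by rintro rfl; simp at hab
  by_cases hs₀ : descendingSlope wassersteinTwo (relEntropy m) μ₀ = ∞
  · simp [hs₀, ha]
  by_cases hs₁ : descendingSlope wassersteinTwo (relEntropy m) μ₁ = ∞
  · simp [hs₁, hb]
  have hcpl := fun (ν : ProbabilityMeasure X) (hν : relEntropy m ν < ∞) (γ : Measure (X × X))
    (hγ : IsCoupling γ ν μ) (hC : ∫⁻ p, edist p.1 p.2 ^ 2 ∂γ ≠ ∞) =>
      relEntropy_sub_le_of_isCoupling hCD ha hb hab hμ h₀ h₁ hν hs₀ hs₁ hγ hC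
  have hμfin := relEntropy_convexCombination_lt_top ha hb hab hμ h₀ h₁
  set s₀ := descendingSlope wassersteinTwo (relEntropy m) μ₀
  set s₁ := descendingSlope wassersteinTwo (relEntropy m) μ₁
  set S := √(a.toReal * s₀.toReal ^ 2 + b.toReal * s₁.toReal ^ 2) with hS
  have hS0 : 0 ≤ S := Real.sqrt_nonneg _
  have hrhs : a * s₀ ^ 2 + b * s₁ ^ 2 = ENNReal.ofReal S ^ 2 := by
    rw [← ENNReal.ofReal_pow hS0, hS, Real.sq_sqrt (by positivity),
      ENNReal.ofReal_add (by positivity) (by positivity), ENNReal.ofReal_mul (by positivity),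
      ENNReal.ofReal_mul (by positivity), ENNReal.ofReal_pow (by positivity),
      ENNReal.ofReal_pow (by positivity), ENNReal.ofReal_toReal ha', ENNReal.ofReal_toReal hb',
      ENNReal.ofReal_toReal hs₀, ENNReal.ofReal_toReal hs₁]
  rw [hrhs]
  gcongr
  -- Optimal plans need not be known to exist: plans of cost below `W₂² + δ` suffice as `δ → 0`.
  have hdrop : ∀ ν : ProbabilityMeasure X, relEntropy m ν < ∞ →
      (relEntropy m μ).toReal - (relEntropy m ν).toReal ≤
        S * (wassersteinTwo ν μ).toReal + |K| / 2 * (wassersteinTwo ν μ).toReal ^ 2 := by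
    intro ν hν
    set w := wassersteinTwo ν μ with hw
    have hwtop : w ≠ ∞ := wassersteinTwo_ne_top ν μ
    have hkey : ∀ᶠ δ : ℝ in nhdsWithin 0 (Ioi 0),
        (relEntropy m μ).toReal - (relEntropy m ν).toReal ≤
          S * √(w.toReal ^ 2 + δ) + |K| / 2 * (w.toReal ^ 2 + δ) := by
      filter_upwards [self_mem_nhdsWithin] with δ hδ
      have hδ' : 0 < δ := hδ
      have hlt : w ^ 2 < w ^ 2 + ENNReal.ofReal δ :=
        ENNReal.lt_add_right (by finiteness) (by simpa using hδ')
      conv_lhs at hlt => rw [hw, wassersteinTwo_sq]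
      simp only [iInf_lt_iff, exists_prop] at hlt
      obtain ⟨γ, hγ, hlt⟩ := hlt
      have h1 := hcpl ν hν γ hγ hlt.ne_top
      have h2 := ENNReal.toReal_mono (by finiteness) hlt.le
      rw [ENNReal.toReal_add (by finiteness) (by finiteness), ENNReal.toReal_pow,
        ENNReal.toReal_ofReal hδ'.le] at h2
      refine h1.trans ?_
      gcongr
    have hlim : Filter.Tendsto
        (fun δ : ℝ => S * √(w.toReal ^ 2 + δ) + |K| / 2 * (w.toReal ^ 2 + δ))
        (nhdsWithin 0 (Ioi 0))
        (nhds (S * √(w.toReal ^ 2 + 0) + |K| / 2 * (w.toReal ^ 2 + 0))) :=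
      (Continuous.tendsto (by fun_prop) 0).mono_left nhdsWithin_le_nhds
    have := ge_of_tendsto hlim hkey
    rwa [add_zero, Real.sqrt_sq ENNReal.toReal_nonneg] at this
  -- At distance at most `ε / (|K|/2 + 1)` the quadratic term is at most `ε` times the distance.
  refine ENNReal.le_of_forall_pos_le_add fun ε hε _ => ?_
  have hr : (0 : ℝ) < ε / (|K| / 2 + 1) := by positivity
  refine (iInf₂_le (ENNReal.ofReal (ε / (|K| / 2 + 1))) (by simpa using hr)).trans ?_
  refine iSup₂_le fun ν ⟨_, hνr⟩ => ?_
  -- This form also covers `W₂(ν,μ) = 0`: the numerator is then shown to vanish.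
  refine ENNReal.div_le_of_le_mul ?_
  by_cases hν : relEntropy m ν = ∞
  · simp [hν]
  have hwtop : wassersteinTwo ν μ ≠ ∞ := wassersteinTwo_ne_top ν μ
  have hwr := (ENNReal.toReal_lt_toReal hwtop ENNReal.ofReal_ne_top).2 hνr
  rw [ENNReal.toReal_ofReal hr.le, lt_div_iff₀ (by positivity)] at hwr
  have hd := hdrop ν (lt_top_iff_ne_top.2 hν)
  have hw0 : 0 ≤ (wassersteinTwo ν μ).toReal := ENNReal.toReal_nonneg
  rw [← ENNReal.ofReal_toReal hμfin.ne, ← ENNReal.ofReal_toReal hν,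
    ← ENNReal.ofReal_sub _ ENNReal.toReal_nonneg, ← ENNReal.ofReal_toReal hwtop,
    ← ENNReal.ofReal_coe_nnreal, ← ENNReal.ofReal_add hS0 ε.coe_nonneg,
    ← ENNReal.ofReal_mul (by positivity)]
  refine ENNReal.ofReal_le_ofReal ?_
  nlinarith [abs_nonneg K]

/-- On a compact, normalized `CD(K,∞)` space the squared descending slope of the relative entropy
is convex, with respect to linear interpolation of measures, on the domain of the entropy. -/
theorem proposition5 {X : Type*} [MetricSpace X] [CompactSpace X] [MeasurableSpace X]
    [BorelSpace X] (m : Measure X) [IsProbabilityMeasure m] (K : ℝ) (hCD : IsCDInfty m K)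
    (μ₀ μ₁ : ProbabilityMeasure X) (h₀ : relEntropy m μ₀ < ∞) (h₁ : relEntropy m μ₁ < ∞)
    (t : unitInterval) :
    relEntropy m (linearInterpolation μ₀ μ₁ t) < ∞ ∧
    descendingSlope wassersteinTwo (relEntropy m) (linearInterpolation μ₀ μ₁ t) ^ 2 ≤
      ENNReal.ofReal (1 - (t : ℝ)) *
          descendingSlope wassersteinTwo (relEntropy m) μ₀ ^ 2 +
        ENNReal.ofReal (t : ℝ) *
          descendingSlope wassersteinTwo (relEntropy m) μ₁ ^ 2 := by
  -- At the end points the weight `0` may meet an infinite slope, and `0 * ∞ = 0`.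
  rcases eq_or_lt_of_le t.2.1 with ht0 | ht0
  · have hμ : linearInterpolation μ₀ μ₁ t = μ₀ := Subtype.ext (by
      simp [linearInterpolation, ← ht0])
    rw [hμ]
    exact ⟨h₀, by simp [← ht0]⟩
  rcases eq_or_lt_of_le t.2.2 with ht1 | ht1
  · have hμ : linearInterpolation μ₀ μ₁ t = μ₁ := Subtype.ext (by
      simp [linearInterpolation, ht1])
    rw [hμ]
    exact ⟨h₁, by simp [ht1]⟩
  have ha : ENNReal.ofReal (1 - (t : ℝ)) ≠ 0 := by simpa using ht1
  have hb : ENNReal.ofReal (t : ℝ) ≠ 0 := by simpa using ht0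
  have hab : ENNReal.ofReal (1 - (t : ℝ)) + ENNReal.ofReal (t : ℝ) = 1 := by
    rw [← ENNReal.ofReal_add (sub_nonneg.2 t.2.2) t.2.1, sub_add_cancel, ENNReal.ofReal_one]
  exact ⟨relEntropy_convexCombination_lt_top ha hb hab rfl h₀ h₁,
    descendingSlope_sq_convexCombination_le hCD ha hb hab rfl h₀ h₁⟩
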